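/- **Setting.** For a finite group $G$ acting on a finite set $X$, the cycle type of $g\in G$ on $X$ is the multiset $c(g)=\{1^{c_1},2^{c_2},\dots\}$, where $c_i$ is the number of $i$-cycles of the permutation of $X$ induced by $g$, and the cycle index is $\frac1{|G|}\sum_{g\in G} z_1^{c_1}z_2^{c_2}\cdots$, a polynomial in the indeterminates $z=(z_1,z_2,\dots)$ over $\mathbb{Q}$. Let $V_n=\{0,1\}^n\subset\mathbb{R}^n$ be the vertex set of the cube $Q_n$ and $B_n$ the group of signed permutations of $\{1,\dots,n\}$, where $w\in B_n$ with underlying permutation $\pi$ acts on $\mathbb{R}^n$ by $w(x)=y$, $y_i=x_{\pi(i)}$ if $i$ has the sign $+$ and $y_i=1-x_{\pi(i)}$ if $i$ has the sign $-$. Let $Z_n(z)$ be the cycle index of $B_n$ acting on $V_n$. A spanned hyperplane of $Q_n$ is the affine span of $n$ affinely independent vertices of $Q_n$. Let $1\le t\le n$ and let $$H\colon\ a_1x_1+a_2x_2+\cdots+a_tx_t=b$$ be a spanned hyperplane of $Q_n$, where $0<a_1\le a_2\le\cdots\le a_t$ and $b\ge 0$ are integers. Let $F(H)=\{w\in B_n: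 w(H)=H\}$, and let $Z_H(z)$ be the cycle index of $F(H)$ acting on $V_n\cap H$. The type of $H$ is $\alpha=(\alpha_1,\dots,\alpha_\ell)$, where $\ell=a_t$ and $\alpha_i$ is the number of indices $j$ with $a_j=i$. Put $I_i=[\alpha_1+\cdots+\alpha_{i-1}+1,\ \alpha_1+\cdots+\alpha_i]$. Let $S_\alpha$ (resp. $\overline S_\alpha$) be the set of signed permutations $\pi$ of $\{1,\dots,t\}$ all of whose signs are $+$ (resp. $-$) and whose underlying permutation maps each $I_i$ to itself; let $\pi_i$ be the restriction of $\pi$ to $I_i$, and let its cycle type be that of its underlying permutation. Put $\delta(H)=1$ if $\sum_{i=1}^t a_i=2b$ and $\delta(H)=0$ otherwise. Regard the equation of $H$ also as that of a hyperplane in $\mathbb{R}^t$, and let $V_t(H)$ be the set of the vertices of $Q_t$ on it. For a symmetry $\pi$ of $Q_t$ that fixes this hyperplane as a set, and whose cycle type on $V_t(H)$ is $\{1^{m_1},2^{m_2},\dots\}$, let $$f_\pi(z_j)=\prod_{i\ge1}\bigl(z_{\mathrm{lcm}(i,j)}\bigr)^{\frac{ijm_i}{\mathrm{lcm}(i,j)}},\qquad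 f_\pi(z)=(f_\pi(z_1),f_\pi(z_2),\dots).$$ For a tuple $(\mu^1,\dots,\mu^\ell)$ of partitions $\mu^i\vdash\alpha_i$, written $\mu$ for short, let $f_\mu(z)=f_\pi(z)$ for any $\pi\in S_\alpha$ such that $\pi_i$ has cycle type $\mu^i$ for all $i$; if $\delta(H)=1$, let $\overline f_\mu(z)=f_\pi(z)$ for any $\pi\in\overline S_\alpha$ such that $\pi_i$ has cycle type $\mu^i$ for all $i$. For a partition $\lambda=\{1^{m_1},2^{m_2},\dots\}$ let $z_\lambda=1^{m_1}m_1!\,2^{m_2}m_2!\cdots$. **Theorem.** Such symmetries $\pi$ fixing $H$ exist, and $f_\mu(z)$ and, if $\delta(H)=1$, also $\overline f_\mu(z)$ do not depend on the choice of $\pi$. Moreover $$Z_H(z)=\frac{1}{2^{\delta(H)}}\sum_{(\mu^1,\ldots,\mu^\ell)}\ \prod_{i=1}^\ell z_{\mu^i}^{-1}\Bigl(Z_{n-t}(f_\mu(z))+\delta(H)\,Z_{n-t}(\overline f_\mu(z))\Bigr),$$ where the sum is over all tuples with $\mu^i\vdash\alpha_i$ for $1\le i\le\ell$. (If $\delta(H)=0$,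 the term with $\overline f_\mu$ is absent.) -/

import Mathlib

open scoped Pointwise

namespace CubeIndex

/-! ### Cycle types and the cycle index of a finite group action -/

/-- The cycle type of a permutation of a finite set, as the multiset of the lengths of all of its
cycles, the fixed points being cycles of length `1`. -/
noncomputable def fullCycleType {X : Type*} [Fintype X] (g : Equiv.Perm X) : Multiset ℕ :=
  letI := Classical.decEq X
  g.partition.parts

/-- The monomial `z^c = z_1^{c_1} z_2^{c_2} ⋯` of a cycle type `c = {1^{c_1}, 2^{c_2}, …}`. -/
noncomputable def cycleMonomial (c : Multiset ℕ) : MvPolynomial ℕ ℚ :=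
  ∏ i ∈ c.toFinset, MvPolynomial.X i ^ c.count i

/-- The cycle index of a finite group `G` acting on a finite set `X`. The indeterminate `z_i` is
`MvPolynomial.X i`, for `i ≥ 1`; the variable `X 0` never occurs. -/
noncomputable def cycleIndex (G X : Type*) [Group G] [Fintype G] [Fintype X] [MulAction G X] :
    MvPolynomial ℕ ℚ :=
  MvPolynomial.C (1 / (Fintype.card G : ℚ)) *
    ∑ g : G, cycleMonomial (fullCycleType (MulAction.toPerm g : Equiv.Perm X))

/-! ### Signed permutations, the hyperoctahedral group -/

/-- A signed permutation of `n` letters: an underlying permutation and, for each letter `i`, a sign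
(`neg i = true` means that `i` has the sign `-`). -/
@[ext]
structure SignedPerm (n : ℕ) where
  perm : Equiv.Perm (Fin n)
  neg : Fin n → Bool

namespace SignedPerm

variable {n : ℕ}

/-- `w x = y`, where `y_i = x_{π(i)}` if `i` has the sign `+`, and `y_i = 1 - x_{π(i)}` if `i` has
the sign `-`, with `π` the underlying permutation of `w`. -/
instance : SMul (SignedPerm n) (Fin n → ℝ) where
  smul w x := fun i => if w.neg i then 1 - x (w.perm i) else x (w.perm i)

theorem smul_apply (w : SignedPerm n) (x : Fin n → ℝ) (i : Fin n) :
    (w • x) i = if w.neg i then 1 - x (w.perm i) else x (w.perm i) := rfl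

instance : One (SignedPerm n) := ⟨⟨1, fun _ => false⟩⟩

/-- The product is the composition of the symmetries: `(w * w') x = w (w' x)`. -/
instance : Mul (SignedPerm n) :=
  ⟨fun w w' => ⟨w'.perm * w.perm, fun i => xor (w.neg i) (w'.neg (w.perm i))⟩⟩

instance : Inv (SignedPerm n) := ⟨fun w => ⟨w.perm⁻¹, fun i => w.neg (w.perm⁻¹ i)⟩⟩

theorem one_perm : (1 : SignedPerm n).perm = 1 := rfl
theorem one_neg (i : Fin n) : (1 : SignedPerm n).neg i = false := rfl
theorem mul_perm (w w' : SignedPerm n) : (w * w').perm = w'.perm * w.perm := rfl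
theorem mul_neg (w w' : SignedPerm n) (i : Fin n) :
    (w * w').neg i = xor (w.neg i) (w'.neg (w.perm i)) := rfl
theorem inv_perm (w : SignedPerm n) : (w⁻¹).perm = w.perm⁻¹ := rfl
theorem inv_neg (w : SignedPerm n) (i : Fin n) : (w⁻¹).neg i = w.neg (w.perm⁻¹ i) := rfl

instance : Group (SignedPerm n) :=
  Group.ofLeftAxioms
    (fun a b c => by
      ext i
      · simp [mul_perm, mul_assoc]
      · simp [mul_perm, mul_neg])
    (fun a => by
      ext i
      · simp [mul_perm, one_perm]
      · simp [mul_neg, one_perm, one_neg])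
    (fun a => by
      ext i
      · simp [mul_perm, one_perm, inv_perm]
      · simp [mul_neg, one_neg, inv_perm, inv_neg])

instance : MulAction (SignedPerm n) (Fin n → ℝ) where
  one_smul x := by
    funext i
    simp [smul_apply, one_perm, one_neg]
  mul_smul w w' x := by
    funext i
    cases h : w.neg i <;> cases h' : w'.neg (w.perm i) <;>
      simp [smul_apply, mul_perm, mul_neg, h, h']

instance : Fintype (SignedPerm n) :=
  Fintype.ofEquiv (Equiv.Perm (Fin n) × (Fin n → Bool))
    ⟨fun p => ⟨p.1, p.2⟩, fun w => (w.perm, w.neg), fun _ => rfl, fun _ => rfl⟩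

end SignedPerm

/-! ### The vertices of the cube and their symmetries -/

/-- The vertex set `V_n` of the cube `Q_n = [0,1]^n`. -/
def vertices (n : ℕ) : Set (Fin n → ℝ) := {x | ∀ i, x i = 0 ∨ x i = 1}

theorem vertices_finite (n : ℕ) : (vertices n).Finite := by
  have h : (Set.univ.pi fun _ : Fin n => ({0, 1} : Set ℝ)).Finite :=
    Set.Finite.pi fun _ => Set.toFinite _
  refine h.subset fun x hx i _ => ?_
  simpa using hx i

noncomputable instance (n : ℕ) : Fintype (vertices n) := (vertices_finite n).fintype

noncomputable instance (n : ℕ) (H : Set (Fin n → ℝ)) : Fintype ↥(vertices n ∩ H) :=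
  ((vertices_finite n).subset Set.inter_subset_left).fintype

theorem smul_mem_vertices {n : ℕ} (w : SignedPerm n) {x : Fin n → ℝ} (hx : x ∈ vertices n) :
    w • x ∈ vertices n := by
  intro i
  rw [SignedPerm.smul_apply]
  rcases hx (w.perm i) with h | h <;> cases w.neg i <;> simp [h]

/-- The action of the symmetry group of the cube on the vertices. -/
instance (n : ℕ) : MulAction (SignedPerm n) (vertices n) where
  smul w x := ⟨w • x.1, smul_mem_vertices w x.2⟩
  one_smul x := Subtype.ext (one_smul _ x.1)
  mul_smul w w' x := Subtype.ext (mul_smul w w' x.1)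

/-- `Z_n(z)`: the cycle index of the hyperoctahedral group acting on the vertices of the cube. -/
noncomputable def cubeCycleIndex (n : ℕ) : MvPolynomial ℕ ℚ :=
  cycleIndex (SignedPerm n) (vertices n)

/-- `F(H) = {w : w(H) = H}`. -/
def fixer {n : ℕ} (H : Set (Fin n → ℝ)) : Subgroup (SignedPerm n) :=
  MulAction.stabilizer (SignedPerm n) H

noncomputable instance {n : ℕ} (H : Set (Fin n → ℝ)) : Fintype (fixer H) := Fintype.ofFinite _

theorem smul_mem_of_fixer {n : ℕ} {H : Set (Fin n → ℝ)} (w : fixer H) {x : Fin n → ℝ}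
    (hx : x ∈ H) : w.1 • x ∈ H := by
  have h : w.1 • H = H := w.2
  have h' : w.1 • x ∈ w.1 • H := Set.smul_mem_smul_set hx
  rwa [h] at h'

/-- The action of `F(H)` on the set `V_n(H)` of the vertices of the cube that lie in `H`. -/
instance {n : ℕ} (H : Set (Fin n → ℝ)) : MulAction (fixer H) ↥(vertices n ∩ H) where
  smul w x := ⟨w.1 • x.1, smul_mem_vertices w.1 x.2.1, smul_mem_of_fixer w x.2.2⟩
  one_smul x := Subtype.ext (one_smul _ x.1)
  mul_smul w w' x := Subtype.ext (mul_smul w.1 w'.1 x.1)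

/-- `Z_H(z)`: the cycle index of `F(H)` acting on `V_n(H)`. -/
noncomputable def hyperplaneCycleIndex {n : ℕ} (H : Set (Fin n → ℝ)) : MvPolynomial ℕ ℚ :=
  cycleIndex (fixer H) ↥(vertices n ∩ H)

/-! ### Spanned hyperplanes and their types -/

/-- The set `a_1 x_1 + ⋯ + a_t x_t = b` in `ℝ^n`, where `t ≤ n`. -/
def hyperplane {n t : ℕ} (htn : t ≤ n) (a : Fin t → ℕ) (b : ℕ) : Set (Fin n → ℝ) :=
  {x | ∑ i : Fin t, (a i : ℝ) * x (Fin.castLE htn i) = b}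

/-- `H` is the affine span of `n` affinely independent vertices of the cube. -/
def IsSpanned {n : ℕ} (H : Set (Fin n → ℝ)) : Prop :=
  ∃ p : Fin n → (Fin n → ℝ), (∀ i, p i ∈ vertices n) ∧ AffineIndependent ℝ p ∧
    (affineSpan ℝ (Set.range p) : Set (Fin n → ℝ)) = H

/-- The length `ℓ` of the type: the largest coefficient. -/
def typeLength {t : ℕ} (a : Fin t → ℕ) : ℕ := Finset.univ.sup a

/-- The type `α = (α_1, …, α_ℓ)`: the multiplicity of `1, …, ℓ` among the coefficients. The index
`k : Fin ℓ` stands for the value `k + 1`. -/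
def hyperplaneType {t : ℕ} (a : Fin t → ℕ) (k : Fin (typeLength a)) : ℕ :=
  (Finset.univ.filter fun j : Fin t => a j = k.1 + 1).card

/-- The interval `[α_1 + ⋯ + α_{k-1} + 1, α_1 + ⋯ + α_k]`; letters are numbered from `0` here. -/
def block {t l : ℕ} (α : Fin l → ℕ) (k : Fin l) : Finset (Fin t) :=
  Finset.univ.filter fun j =>
    ∑ i ∈ Finset.Iio k, α i ≤ j.1 ∧ j.1 < ∑ i ∈ Finset.Iic k, α i

/-- The Young subgroup `S_α`, inside the signed permutations: all signs are `+`, and each block is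
mapped to itself. -/
def young {t l : ℕ} (α : Fin l → ℕ) : Set (SignedPerm t) :=
  {w | (∀ j, w.neg j = false) ∧ ∀ k j, w.perm j ∈ block α k ↔ j ∈ block α k}

/-- The set `S̄_α`: all signs are `-`, and each block is mapped to itself. -/
def youngBar {t l : ℕ} (α : Fin l → ℕ) : Set (SignedPerm t) :=
  {w | (∀ j, w.neg j = true) ∧ ∀ k j, w.perm j ∈ block α k ↔ j ∈ block α k}

/-- `σ = π_1 ⋯ π_ℓ` where `π_k` is a permutation of the `k`-th block, of cycle type `μ^k`. -/
def HasBlockTypes {t l : ℕ} {α : Fin l → ℕ} (μ : ∀ k, (α k).Partition)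
    (σ : Equiv.Perm (Fin t)) : Prop :=
  ∀ k, ∃ h : ∀ j, σ j ∈ block α k ↔ j ∈ block α k,
    fullCycleType (σ.subtypePerm (p := fun j => j ∈ block α k) h) = (μ k).parts

/-! ### The ingredients of the formula -/

/-- `z_λ = 1^{m_1} m_1! 2^{m_2} m_2! ⋯` for the partition `λ = {1^{m_1}, 2^{m_2}, …}`. -/
def zNumber {m : ℕ} (lam : m.Partition) : ℕ :=
  ∏ i ∈ lam.parts.toFinset, i ^ lam.parts.count i * (lam.parts.count i).factorial

/-- `f(z_j) = ∏_i z_{lcm(i,j)}^{i j m_i / lcm(i,j)}` for the cycle type `{1^{m_1}, 2^{m_2}, …}`. -/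
noncomputable def fOfCycleType (c : Multiset ℕ) (j : ℕ) : MvPolynomial ℕ ℚ :=
  ∏ i ∈ c.toFinset, MvPolynomial.X (Nat.lcm i j) ^ (i * j * c.count i / Nat.lcm i j)

/-- The sequence `f_π(z) = (f_π(z_1), f_π(z_2), …)` of a symmetry `π` that fixes `H`, where
`{1^{m_1}, 2^{m_2}, …}` is the cycle type of `π` on the vertices of the cube lying in `H`. -/
noncomputable def fOf {t : ℕ} {H : Set (Fin t → ℝ)} (π : fixer H) (j : ℕ) : MvPolynomial ℕ ℚ :=
  fOfCycleType (fullCycleType (MulAction.toPerm π : Equiv.Perm ↥(vertices t ∩ H))) j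

/-- `F` is `f_μ(z)`: it is `f_π(z)` for some `π = π_1 ⋯ π_ℓ` in `S_α` with `π_k` of cycle type
`μ^k`; here `a_1 x_1 + ⋯ + a_t x_t = b` is taken as a hyperplane in `ℝ^t`. -/
def IsFmu {t : ℕ} (a : Fin t → ℕ) (b : ℕ) (μ : ∀ k, (hyperplaneType a k).Partition)
    (F : ℕ → MvPolynomial ℕ ℚ) : Prop :=
  ∃ π : fixer (hyperplane (le_refl t) a b),
    π.1 ∈ young (hyperplaneType a) ∧ HasBlockTypes μ π.1.perm ∧ F = fOf π

/-- `F` is `f̄_μ(z)`: it is `f_π(z)` for some `π = π_1 ⋯ π_ℓ` in `S̄_α` with `π_k` of cycle type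
`μ^k`. -/
def IsFmuBar {t : ℕ} (a : Fin t → ℕ) (b : ℕ) (μ : ∀ k, (hyperplaneType a k).Partition)
    (F : ℕ → MvPolynomial ℕ ℚ) : Prop :=
  ∃ π : fixer (hyperplane (le_refl t) a b),
    π.1 ∈ youngBar (hyperplaneType a) ∧ HasBlockTypes μ π.1.perm ∧ F = fOf π

/-- `δ(H) = 1` if `a_1 + ⋯ + a_t = 2 b`, and `δ(H) = 0` otherwise. -/
def delta {t : ℕ} (a : Fin t → ℕ) (b : ℕ) : ℕ := if ∑ i, a i = 2 * b then 1 else 0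

end CubeIndex

open CubeIndex

/-!
A symmetry `w` of the cube fixes `H` exactly when it carries the equation of `H` to a multiple of
itself. Comparing the sums of the absolute values of the coefficients, the factor is `±1`; so the
underlying permutation preserves the coefficients, the letters `1, …, t` all have the same sign,
and the sign `-` requires `a_1 + ⋯ + a_t = 2 b`. Hence `F(H)` is the product of the stabilizer
`F_t(H)` of the hyperplane in `ℝ^t` and `B_{n-t}`, acting on `V_t(H) × V_{n-t}`. An `i`-cycle times
a `j`-cycle splits into `gcd(i, j)` cycles of length `lcm(i, j)`, so `Z_H` is the average of
`Z_{n-t}(f_π)` over `π ∈ F_t(H)`. Finally, `F_t(H)` consists of `S_α` and, if `δ(H) = 1`, of `S̄_α`;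
on each of the two, `f_π` depends only on the conjugacy class of `π` under `S_α`, that is, on the
tuple `μ` of the cycle types on the blocks, and the class of `μ` has `|S_α| / ∏ z_{μ^i}` elements.
-/

namespace CubeIndex

section CycleTypes

open Function Equiv.Perm

variable {X Y : Type*} [Fintype X] [Fintype Y]

theorem minimalPeriod_eq_card_support_cycleOf [DecidableEq X] (g : Equiv.Perm X) {x : X}
    (hx : g x ≠ x) : minimalPeriod g x = (g.cycleOf x).support.card := by
  have periodic_iff (n : ℕ) : IsPeriodicPt g n x ↔ (g.cycleOf x).support.card ∣ n := by
    rw [← (g.isCycleOn_support_cycleOf x).pow_apply_eq ((mem_support_cycleOf_iff' hx).2 .rfl),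
      IsPeriodicPt, IsFixedPt, iterate_eq_pow]
  exact Nat.dvd_antisymm ((periodic_iff _).2 dvd_rfl).minimalPeriod_dvd
    ((periodic_iff _).1 (isPeriodicPt_minimalPeriod g x))

theorem fullCycleType_eq_cycleType_add [DecidableEq X] (g : Equiv.Perm X) :
    fullCycleType g =
      g.cycleType + Multiset.replicate (Fintype.card X - g.support.card) 1 := by
  rw [fullCycleType, ← parts_partition]
  congr!

theorem fullCycleType_pos (g : Equiv.Perm X) {i : ℕ} (hi : i ∈ fullCycleType g) : 0 < i := by
  classical exact Nat.Partition.parts_pos _ hi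

theorem sum_support_minimalPeriod [DecidableEq X] {M : Type*} [AddCommMonoid M]
    (g : Equiv.Perm X) (φ : ℕ → M) :
    ∑ x ∈ g.support, φ (minimalPeriod g x) = (g.cycleType.map fun i => i • φ i).sum := by
  have maps : ∀ x ∈ g.support, g.cycleOf x ∈ g.cycleFactorsFinset := fun x hx =>
    cycleOf_mem_cycleFactorsFinset_iff.2 hx
  rw [← Finset.sum_fiberwise_of_maps_to maps, cycleType_def, Multiset.map_map]
  refine Finset.sum_congr rfl fun c hc => ?_
  have fiber : g.support.filter (fun x => g.cycleOf x = c) = c.support := by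
    ext x
    rw [Finset.mem_filter]
    refine ⟨?_, fun hx => ⟨mem_cycleFactorsFinset_support_le hc hx, (cycle_is_cycleOf hx hc).symm⟩⟩
    rintro ⟨hx, rfl⟩
    exact (mem_support_cycleOf_iff' (mem_support.1 hx)).2 .rfl
  rw [fiber]
  refine Finset.sum_eq_card_nsmul fun x hx => ?_
  rw [minimalPeriod_eq_card_support_cycleOf g
    (mem_support.1 (mem_cycleFactorsFinset_support_le hc hx)), ← cycle_is_cycleOf hx hc]
  rfl

theorem sum_minimalPeriod {M : Type*} [AddCommMonoid M] (g : Equiv.Perm X) (φ : ℕ → M) :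
    ∑ x, φ (minimalPeriod g x) = ((fullCycleType g).map fun i => i • φ i).sum := by
  classical
  rw [fullCycleType_eq_cycleType_add, Multiset.map_add, Multiset.sum_add,
    ← sum_support_minimalPeriod, ← Finset.sum_add_sum_compl g.support, Multiset.map_replicate,
    Multiset.sum_replicate, one_smul, ← Finset.card_compl]
  congr 1
  refine Finset.sum_eq_card_nsmul fun x hx => ?_
  rw [Finset.mem_compl, Equiv.Perm.notMem_support] at hx
  rw [minimalPeriod_eq_one_iff_isFixedPt.2 hx]

theorem fullCycleType_eq_of_sum_minimalPeriod {g : Equiv.Perm X} {c : Multiset ℕ}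
    (hc : ∀ i ∈ c, 0 < i)
    (h : ∀ φ : ℕ → ℕ, ∑ x, φ (minimalPeriod g x) = (c.map fun i => i • φ i).sum) :
    fullCycleType g = c := by
  -- Taking the indicator of `k` for `φ` reads off `k` times the number of `k`-cycles.
  have sum_indicator (d : Multiset ℕ) (k : ℕ) :
      (d.map fun i => i • if i = k then 1 else 0).sum = d.count k * k := by
    rw [Multiset.sum_map_eq_nsmul_single k fun i hik _ => by rw [if_neg hik, smul_zero]]
    simp
  ext k
  rcases Nat.eq_zero_or_pos k with rfl | hk
  · rw [Multiset.count_eq_zero.2 fun h0 => (fullCycleType_pos g h0).false,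
      Multiset.count_eq_zero.2 fun h0 => (hc 0 h0).false]
  · refine Nat.eq_of_mul_eq_mul_right hk ?_
    rw [← sum_indicator, ← sum_indicator, ← sum_minimalPeriod, ← h]

theorem fullCycleType_eq_of_semiconj (e : X ≃ Y) {g : Equiv.Perm X} {h : Equiv.Perm Y}
    (H : Semiconj e g h) : fullCycleType g = fullCycleType h := by
  refine fullCycleType_eq_of_sum_minimalPeriod (fun _ => fullCycleType_pos h) fun φ => ?_
  rw [← sum_minimalPeriod, ← e.sum_comp]
  refine Finset.sum_congr rfl fun x _ => congrArg φ ?_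
  refine minimalPeriod_eq_minimalPeriod_iff.2 fun n => ?_
  rw [IsPeriodicPt, IsPeriodicPt, IsFixedPt, IsFixedPt, ← (H.iterate_right n).eq,
    e.injective.eq_iff]

theorem isConj_iff_fullCycleType_eq {σ τ : Equiv.Perm X} :
    IsConj σ τ ↔ fullCycleType σ = fullCycleType τ := by
  classical exact partition_eq_of_isConj.trans Nat.Partition.ext_iff

theorem fullCycleType_toPerm_eq_of_isConj {G : Type*} [Group G] [MulAction G X] {g h : G}
    (hgh : IsConj g h) :
    fullCycleType (MulAction.toPerm g : Equiv.Perm X) =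
      fullCycleType (MulAction.toPerm h : Equiv.Perm X) :=
  isConj_iff_fullCycleType_eq.1 ((MulAction.toPermHom G X).map_isConj hgh)

/-- The cycle type of `g × h` in terms of the cycle types `c` of `g` and `d` of `h`: an `i`-cycle
times a `j`-cycle splits into `gcd i j` cycles of length `lcm i j`. -/
def prodCycleType (c d : Multiset ℕ) : Multiset ℕ :=
  c.bind fun i => d.bind fun j => Multiset.replicate (Nat.gcd i j) (Nat.lcm i j)

theorem prodCycleType_pos {c d : Multiset ℕ} (hc : ∀ i ∈ c, 0 < i) (hd : ∀ i ∈ d, 0 < i) :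
    ∀ i ∈ prodCycleType c d, 0 < i := by
  intro k hk
  simp only [prodCycleType, Multiset.mem_bind] at hk
  obtain ⟨i, hi, j, hj, hk⟩ := hk
  rw [Multiset.eq_of_mem_replicate hk]
  exact Nat.lcm_pos (hc i hi) (hd j hj)

theorem fullCycleType_prodCongr (g : Equiv.Perm X) (h : Equiv.Perm Y) :
    fullCycleType (g.prodCongr h : Equiv.Perm (X × Y)) =
      prodCycleType (fullCycleType g) (fullCycleType h) := by
  refine fullCycleType_eq_of_sum_minimalPeriod
    (prodCycleType_pos (fun _ => fullCycleType_pos g) fun _ => fullCycleType_pos h) fun φ => ?_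
  have minimalPeriod_pair (x : X) (y : Y) : minimalPeriod (g.prodCongr h) (x, y) =
      Nat.lcm (minimalPeriod g x) (minimalPeriod h y) := minimalPeriod_prodMap g h (x, y)
  have inner_sum (i : ℕ) : ∑ y, φ (Nat.lcm i (minimalPeriod h y)) =
      ((fullCycleType h).map fun j => j • φ (Nat.lcm i j)).sum :=
    sum_minimalPeriod h fun j => φ (Nat.lcm i j)
  simp only [Fintype.sum_prod_type, minimalPeriod_pair, inner_sum]
  rw [sum_minimalPeriod g fun i => ((fullCycleType h).map fun j => j • φ (Nat.lcm i j)).sum]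
  simp only [prodCycleType, Multiset.map_bind, Multiset.sum_bind, Multiset.map_replicate,
    Multiset.sum_replicate, smul_eq_mul, Multiset.sum_map_mul_left.symm, ← mul_assoc,
    Nat.gcd_mul_lcm]

theorem cycleMonomial_eq_prod_map (c : Multiset ℕ) :
    cycleMonomial c = (c.map fun i => (MvPolynomial.X i : MvPolynomial ℕ ℚ)).prod := by
  rw [cycleMonomial, Finset.prod_multiset_map_count]

theorem fOfCycleType_eq_prod_map {c : Multiset ℕ} (hc : ∀ i ∈ c, 0 < i) {j : ℕ} (hj : 0 < j) :
    fOfCycleType c j =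
      (c.map fun i => (MvPolynomial.X (Nat.lcm i j) : MvPolynomial ℕ ℚ) ^ Nat.gcd i j).prod := by
  rw [fOfCycleType, Finset.prod_multiset_map_count]
  refine Finset.prod_congr rfl fun i hi => ?_
  have lcm_pos : 0 < Nat.lcm i j := Nat.lcm_pos (hc i (Multiset.mem_toFinset.1 hi)) hj
  rw [← pow_mul, ← Nat.gcd_mul_lcm i j, mul_right_comm, Nat.mul_div_cancel _ lcm_pos]

theorem cycleMonomial_prodCycleType {c d : Multiset ℕ} (hc : ∀ i ∈ c, 0 < i)
    (hd : ∀ i ∈ d, 0 < i) :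
    cycleMonomial (prodCycleType c d) =
      MvPolynomial.bind₁ (fOfCycleType c) (cycleMonomial d) := by
  have bind_factor : d.map (MvPolynomial.bind₁ (fOfCycleType c) ∘ fun j => MvPolynomial.X j) =
      d.map fun j => (c.map fun i =>
        (MvPolynomial.X (Nat.lcm i j) : MvPolynomial ℕ ℚ) ^ Nat.gcd i j).prod :=
    Multiset.map_congr rfl fun j hj => by
      rw [comp_apply, MvPolynomial.bind₁_X_right, fOfCycleType_eq_prod_map hc (hd j hj)]
  rw [cycleMonomial_eq_prod_map, cycleMonomial_eq_prod_map, map_multiset_prod, Multiset.map_map,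
    bind_factor, Multiset.prod_map_prod_map]
  simp only [prodCycleType, Multiset.map_bind, Multiset.prod_bind, Multiset.map_replicate,
    Multiset.prod_replicate]

end CycleTypes

section Counting

variable {X : Type*} [Fintype X] {m : ℕ}

theorem parts_eq_filter_add_replicate (μ : m.Partition) :
    μ.parts = μ.parts.filter (2 ≤ ·) +
      Multiset.replicate (m - (μ.parts.filter (2 ≤ ·)).sum) 1 := by
  have filter_one : μ.parts.filter (¬2 ≤ ·) = Multiset.replicate (μ.parts.count 1) 1 := by
    rw [← Multiset.filter_eq']
    refine Multiset.filter_congr fun i hi => ?_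
    have := μ.parts_pos hi
    omega
  have parts_eq := Multiset.filter_add_not (2 ≤ ·) μ.parts
  rw [filter_one] at parts_eq
  have sum_eq := congrArg Multiset.sum parts_eq
  rw [Multiset.sum_add, μ.parts_sum, Multiset.sum_replicate, smul_eq_mul, mul_one] at sum_eq
  rw [← Nat.eq_sub_of_add_eq' sum_eq, parts_eq]

theorem fullCycleType_eq_parts_iff [DecidableEq X] (μ : (Fintype.card X).Partition)
    (σ : Equiv.Perm X) :
    fullCycleType σ = μ.parts ↔ σ.cycleType = μ.parts.filter (2 ≤ ·) := by
  constructor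
  · intro h
    rw [← h, fullCycleType_eq_cycleType_add, ← Equiv.Perm.parts_partition,
      Equiv.Perm.filter_parts_partition_eq_cycleType]
  · intro h
    rw [fullCycleType_eq_cycleType_add, parts_eq_filter_add_replicate μ, ← h,
      Equiv.Perm.sum_cycleType]

theorem zNumber_eq (μ : m.Partition) :
    zNumber μ = (m - (μ.parts.filter (2 ≤ ·)).sum).factorial *
      (μ.parts.filter (2 ≤ ·)).prod *
      ∏ i ∈ (μ.parts.filter (2 ≤ ·)).toFinset,
        ((μ.parts.filter (2 ≤ ·)).count i).factorial := by
  set c := μ.parts.filter (2 ≤ ·) with hc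
  have one_notMem : 1 ∉ c.toFinset := by simp [hc]
  have subset : μ.parts.toFinset ⊆ insert 1 c.toFinset := by
    intro i hi
    have := μ.parts_pos (Multiset.mem_toFinset.1 hi)
    simp only [Finset.mem_insert, Multiset.mem_toFinset, hc, Multiset.mem_filter]
    rw [Multiset.mem_toFinset] at hi
    grind
  have count_one : μ.parts.count 1 = m - c.sum := by
    rw [parts_eq_filter_add_replicate, Multiset.count_add, Multiset.count_replicate_self,
      Multiset.count_eq_zero.2 (by simp), zero_add]
  rw [zNumber, Finset.prod_subset subset fun i _ hi => by
      simp [Multiset.count_eq_zero.2 (mt Multiset.mem_toFinset.2 hi)],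
    Finset.prod_insert one_notMem, one_pow, one_mul, count_one, mul_assoc,
    Finset.prod_multiset_count c, ← Finset.prod_mul_distrib]
  congr 1
  refine Finset.prod_congr rfl fun i hi => ?_
  rw [hc, Multiset.count_filter_of_pos]
  exact (Multiset.mem_filter.1 (Multiset.mem_toFinset.1 hi)).2

theorem card_fullCycleType_mul_zNumber [DecidableEq X] (μ : (Fintype.card X).Partition) :
    (Finset.univ.filter fun σ : Equiv.Perm X => fullCycleType σ = μ.parts).card * zNumber μ =
      (Fintype.card X).factorial := by
  have sum_le : (μ.parts.filter (2 ≤ ·)).sum ≤ Fintype.card X := by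
    have sum_eq := congrArg Multiset.sum (parts_eq_filter_add_replicate μ)
    rw [μ.parts_sum, Multiset.sum_add] at sum_eq
    omega
  simp only [fullCycleType_eq_parts_iff, zNumber_eq]
  rw [Equiv.Perm.card_of_cycleType_mul_eq,
    if_pos ⟨sum_le, fun i hi => (Multiset.mem_filter.1 hi).2⟩]

theorem exists_fullCycleType_eq (μ : (Fintype.card X).Partition) :
    ∃ σ : Equiv.Perm X, fullCycleType σ = μ.parts := by
  classical
  have card_pos := card_fullCycleType_mul_zNumber μ ▸ Nat.factorial_pos (Fintype.card X)
  obtain ⟨σ, hσ⟩ := Finset.card_pos.1 (Nat.pos_of_mul_pos_right card_pos)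
  exact ⟨σ, (Finset.mem_filter.1 hσ).2⟩

end Counting

section Stabilizer

theorem exists_eq_smul_of_levelSet_subset {K V : Type*} [Field K] [AddCommGroup V] [Module K V]
    {φ ψ : V →ₗ[K] K} (hφ : φ ≠ 0) {b d : K} (h : ∀ x, φ x = b → ψ x = d) :
    ∃ c, ψ = c • φ ∧ d = c * b := by
  obtain ⟨x₀, hx₀⟩ := LinearMap.surjective hφ b
  have ker_le : ⨅ _ : Unit, φ.ker ≤ ψ.ker := by
    rw [iInf_const]
    intro y hy
    have := h (x₀ + y) (by rw [map_add, hx₀, LinearMap.mem_ker.1 hy, add_zero])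
    rwa [map_add, h x₀ hx₀, add_eq_left] at this
  have mem_span := mem_span_of_iInf_ker_le_ker (L := fun _ : Unit => φ) ker_le
  rw [Set.range_const, Submodule.mem_span_singleton] at mem_span
  obtain ⟨c, rfl⟩ := mem_span
  exact ⟨c, rfl, by rw [← h x₀ hx₀, LinearMap.smul_apply, hx₀, smul_eq_mul]⟩

namespace SignedPerm

variable {n : ℕ}

/-- The sign of the letter `i` in `w`, as a real number. -/
def sign (w : SignedPerm n) (i : Fin n) : ℝ := if w.neg i then -1 else 1

theorem abs_sign (w : SignedPerm n) (i : Fin n) : |w.sign i| = 1 := by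
  unfold sign
  split_ifs <;> simp

theorem sum_mul_smul (w : SignedPerm n) (A x : Fin n → ℝ) :
    ∑ i, A i * (w • x) i =
      ∑ i, w.sign i * A i * x (w.perm i) + ∑ i, if w.neg i then A i else 0 := by
  rw [← Finset.sum_add_distrib]
  refine Finset.sum_congr rfl fun i _ => ?_
  rw [smul_apply, sign]
  split_ifs <;> ring

theorem mem_fixer_of_uniform {w : SignedPerm n} {A : Fin n → ℝ} {b : ℝ} {s : Bool}
    (hperm : ∀ i, A (w.perm i) = A i) (hneg : ∀ i, A i ≠ 0 → w.neg i = s)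
    (hs : s = true → ∑ i, A i = 2 * b) :
    w ∈ fixer {x | ∑ i, A i * x i = b} := by
  have sum_eq (x : Fin n → ℝ) : ∑ i, A i * (w • x) i =
      if s then ∑ i, A i - ∑ i, A i * x i else ∑ i, A i * x i := by
    rw [← Equiv.sum_comp w.perm fun i => A i * x i, ← Finset.sum_sub_distrib,
      ← Finset.sum_ite_irrel]
    refine Finset.sum_congr rfl fun i _ => ?_
    rw [hperm, smul_apply]
    rcases eq_or_ne (A i) 0 with h0 | h0
    · simp [h0]
    · rw [hneg i h0, mul_ite, mul_one_sub]
  rw [fixer, MulAction.mem_stabilizer_set]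
  intro x
  simp only [Set.mem_ofPred_eq, sum_eq]
  split_ifs with h
  · rw [hs h]
    constructor <;> intro <;> linarith
  · rfl

theorem exists_scale_of_mem_fixer {w : SignedPerm n} {A : Fin n → ℝ} (hA : A ≠ 0) {b : ℝ}
    (hw : w ∈ fixer {x | ∑ i, A i * x i = b}) :
    ∃ c, (∀ i, w.sign i * A i = c * A (w.perm i)) ∧
      b - (∑ i, if w.neg i then A i else 0) = c * b := by
  rw [fixer, MulAction.mem_stabilizer_set] at hw
  set B : Fin n → ℝ := fun i => w.sign (w.perm⁻¹ i) * A (w.perm⁻¹ i) with hB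
  have sum_B (x : Fin n → ℝ) : ∑ i, w.sign i * A i * x (w.perm i) = ∑ i, B i * x i := by
    rw [← Equiv.sum_comp w.perm fun i => B i * x i]
    simp [hB]
  obtain ⟨c, hc, hcb⟩ := exists_eq_smul_of_levelSet_subset (φ := dotProductBilin ℝ ℝ A)
    (ψ := dotProductBilin ℝ ℝ B) (b := b) (d := b - ∑ i, if w.neg i then A i else 0)
    (fun h => hA (funext fun i => by simpa using LinearMap.congr_fun h (Pi.single i 1)))
    fun x hx => by
      have := (hw x).2 hx
      rw [Set.mem_ofPred_eq, sum_mul_smul, sum_B] at this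
      exact eq_sub_of_add_eq this
  refine ⟨c, fun i => ?_, hcb⟩
  have := LinearMap.congr_fun hc (Pi.single (w.perm i) 1)
  simpa [hB] using this

theorem abs_scale_eq_one {w : SignedPerm n} {A : Fin n → ℝ} (hA : A ≠ 0) (hA0 : 0 ≤ A) {c : ℝ}
    (hc : ∀ i, w.sign i * A i = c * A (w.perm i)) : |c| = 1 := by
  have scale_abs (i : Fin n) : A i = |c| * A (w.perm i) := by
    rw [← abs_of_nonneg (hA0 (w.perm i)), ← abs_mul, ← hc, abs_mul, abs_sign, one_mul,
      abs_of_nonneg (hA0 i)]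
  have sum_ne : ∑ i, A i ≠ 0 := fun h =>
    hA ((Fintype.sum_eq_zero_iff_of_nonneg hA0).1 h)
  have sum_scale : ∑ i, A i = |c| * ∑ i, A i := by
    rw [← Equiv.sum_comp w.perm A, Finset.mul_sum, ← Finset.sum_congr rfl fun i _ => scale_abs i,
      Equiv.sum_comp w.perm A]
  exact (mul_eq_right₀ sum_ne).1 sum_scale.symm

theorem mem_fixer_iff {w : SignedPerm n} {A : Fin n → ℝ} (hA : A ≠ 0) (hA0 : 0 ≤ A) {b : ℝ} :
    w ∈ fixer {x | ∑ i, A i * x i = b} ↔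
      (∀ i, A (w.perm i) = A i) ∧
        ∃ s : Bool, (∀ i, A i ≠ 0 → w.neg i = s) ∧ (s = true → ∑ i, A i = 2 * b) := by
  refine ⟨fun hw => ?_, fun ⟨hperm, s, hneg, hs⟩ => mem_fixer_of_uniform hperm hneg hs⟩
  obtain ⟨c, hc, hcb⟩ := exists_scale_of_mem_fixer hA hw
  have abs_c := abs_scale_eq_one hA hA0 hc
  have hperm (i : Fin n) : A (w.perm i) = A i := by
    have := congrArg abs (hc i)
    rwa [abs_mul, abs_mul, abs_sign, abs_c, one_mul, one_mul, abs_of_nonneg (hA0 _),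
      abs_of_nonneg (hA0 _), eq_comm] at this
  have sign_eq (i : Fin n) (hi : A i ≠ 0) : w.sign i = c :=
    mul_right_cancel₀ hi ((hc i).trans (by rw [hperm]))
  refine ⟨hperm, decide (c = -1), fun i hi => ?_, fun h => ?_⟩
  · rw [← sign_eq i hi, sign]
    cases w.neg i <;> norm_num
  · rw [decide_eq_true_iff] at h
    have sum_neg : (∑ i, if w.neg i then A i else 0) = ∑ i, A i := by
      refine Finset.sum_congr rfl fun i _ => ?_
      rcases eq_or_ne (A i) 0 with h0 | h0
      · rw [h0, ite_self]
      · have := sign_eq i h0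
        rw [h, sign, ite_eq_left_iff] at this
        rw [if_pos (by_contra fun hneg => by norm_num [hneg] at this)]
    linarith [h ▸ hcb]

end SignedPerm

end Stabilizer

section ProductActions

open MvPolynomial in
theorem cycleIndex_eq_of_prodEquiv {G G' K X X' Y : Type*} [Group G] [Group G'] [Group K]
    [Fintype G] [Fintype G'] [Fintype K] [Fintype X] [Fintype X'] [Fintype Y]
    [MulAction G X] [MulAction G' X'] [MulAction K Y] (e : G × G' ≃ K) (f : X × X' ≃ Y)
    (hf : ∀ g g' x x', f (g • x, g' • x') = e (g, g') • f (x, x')) :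
    cycleIndex K Y = C (1 / (Fintype.card G : ℚ)) *
      ∑ g : G, bind₁ (fOfCycleType (fullCycleType (MulAction.toPerm g : Equiv.Perm X)))
        (cycleIndex G' X') := by
  have cycleMonomial_pair (g : G) (g' : G') :
      cycleMonomial (fullCycleType (MulAction.toPerm (e (g, g')) : Equiv.Perm Y)) =
        bind₁ (fOfCycleType (fullCycleType (MulAction.toPerm g : Equiv.Perm X)))
          (cycleMonomial (fullCycleType (MulAction.toPerm g' : Equiv.Perm X'))) := by
    have semiconj : Function.Semiconj f ((MulAction.toPerm g).prodCongr (MulAction.toPerm g'))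
        (MulAction.toPerm (e (g, g'))) := fun ⟨x, x'⟩ => hf g g' x x'
    rw [← fullCycleType_eq_of_semiconj f semiconj, fullCycleType_prodCongr,
      cycleMonomial_prodCycleType (fun _ => fullCycleType_pos _) fun _ => fullCycleType_pos _]
  have card_eq : C (1 / (Fintype.card K : ℚ)) =
      C (1 / (Fintype.card G : ℚ)) * (C (1 / (Fintype.card G' : ℚ)) : MvPolynomial ℕ ℚ) := by
    rw [← C_mul, div_mul_div_comm, one_mul, ← Nat.cast_mul, ← Fintype.card_prod,
      Fintype.card_congr e]
  simp only [cycleIndex, map_mul, map_sum, algHom_C, algebraMap_eq, ← cycleMonomial_pair,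
    ← Finset.mul_sum]
  rw [card_eq, mul_assoc, ← e.sum_comp, Fintype.sum_prod_type]

end ProductActions

section Gluing

variable {t m : ℕ}

namespace SignedPerm

/-- The symmetry of the cube `Q_{t+m} = Q_t × Q_m` that acts by `v` on `Q_t` and by `w` on
`Q_m`. -/
def glue (v : SignedPerm t) (w : SignedPerm m) : SignedPerm (t + m) where
  perm := finSumFinEquiv.permCongr (Equiv.sumCongr v.perm w.perm)
  neg := Fin.append v.neg w.neg

theorem glue_smul_append (v : SignedPerm t) (w : SignedPerm m) (x : Fin t → ℝ)
    (y : Fin m → ℝ) : glue v w • Fin.append x y = Fin.append (v • x) (w • y) := by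
  funext i
  induction i using Fin.addCases <;> simp [smul_apply, glue]

theorem glue_inj {v v' : SignedPerm t} {w w' : SignedPerm m} :
    glue v w = glue v' w' ↔ v = v' ∧ w = w' := by
  refine ⟨fun h => ?_, fun ⟨hv, hw⟩ => hv ▸ hw ▸ rfl⟩
  obtain ⟨perm_eq, neg_eq⟩ := SignedPerm.ext_iff.1 h
  have perm_eq' := Equiv.ext_iff.1 ((finSumFinEquiv.permCongr).injective perm_eq)
  obtain ⟨neg_left, neg_right⟩ := Prod.ext_iff.1 <|
    (Fin.appendEquiv t m).injective (a₁ := (v.neg, w.neg)) (a₂ := (v'.neg, w'.neg)) neg_eq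
  exact ⟨SignedPerm.ext (Equiv.ext fun i => Sum.inl_injective (perm_eq' (.inl i))) neg_left,
    SignedPerm.ext (Equiv.ext fun i => Sum.inr_injective (perm_eq' (.inr i))) neg_right⟩

theorem exists_glue_eq (u : SignedPerm (t + m))
    (hu : ∀ i, ∃ j, u.perm (Fin.castAdd m i) = Fin.castAdd m j) :
    ∃ (v : SignedPerm t) (w : SignedPerm m), glue v w = u := by
  have mapsTo : Set.MapsTo (finSumFinEquiv.symm.permCongr u.perm)
      (Set.range (Sum.inl : Fin t → Fin t ⊕ Fin m)) (Set.range Sum.inl) := by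
    rintro _ ⟨i, rfl⟩
    obtain ⟨j, hj⟩ := hu i
    exact ⟨j, by simp [Equiv.permCongr_apply, hj]⟩
  obtain ⟨⟨σ, τ⟩, hστ⟩ := Equiv.Perm.mem_sumCongrHom_range_of_perm_mapsTo_inl mapsTo
  rw [Equiv.Perm.sumCongrHom_apply] at hστ
  refine ⟨⟨σ, fun i => u.neg (Fin.castAdd m i)⟩, ⟨τ, fun i => u.neg (Fin.natAdd t i)⟩,
    SignedPerm.ext ?_ (Fin.append_castAdd_natAdd)⟩
  change finSumFinEquiv.permCongr (Equiv.Perm.sumCongr σ τ) = u.perm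
  rw [hστ]
  exact finSumFinEquiv.permCongr.apply_symm_apply u.perm

end SignedPerm

open SignedPerm

variable {a : Fin t → ℕ} {b : ℕ} (h : t ≤ t + m)

theorem append_mem_vertices_iff {x : Fin t → ℝ} {y : Fin m → ℝ} :
    Fin.append x y ∈ vertices (t + m) ↔ x ∈ vertices t ∧ y ∈ vertices m := by
  simp [vertices, Fin.forall_fin_add]

theorem append_mem_hyperplane_iff {x : Fin t → ℝ} {y : Fin m → ℝ} :
    Fin.append x y ∈ hyperplane h a b ↔ x ∈ hyperplane le_rfl a b := by
  have append_left (i : Fin t) : Fin.append x y (Fin.castLE h i) = x i := Fin.append_left x y i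
  simp only [hyperplane, Set.mem_ofPred_eq, append_left, Fin.castLE_rfl, id]

theorem glue_mem_fixer_iff {v : SignedPerm t} {w : SignedPerm m} :
    glue v w ∈ fixer (hyperplane h a b) ↔ v ∈ fixer (hyperplane le_rfl a b) := by
  simp only [fixer, MulAction.mem_stabilizer_set]
  constructor
  · intro H x
    simpa only [glue_smul_append, append_mem_hyperplane_iff] using H (Fin.append x 0)
  · intro H z
    obtain ⟨⟨x, y⟩, rfl⟩ := (Fin.appendEquiv t m).surjective z
    simpa only [Fin.appendEquiv, Equiv.coe_fn_mk, glue_smul_append, append_mem_hyperplane_iff]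
      using H x

theorem hyperplane_eq_setOf_append :
    hyperplane h a b =
      {x | ∑ i, (Fin.append (fun i => (a i : ℝ)) 0 : Fin (t + m) → ℝ) i * x i = b} := by
  ext x
  simp only [hyperplane, Set.mem_ofPred_eq, Fin.sum_univ_add, Fin.append_left, Fin.append_right,
    Pi.zero_apply, zero_mul, Finset.sum_const_zero, add_zero]
  rfl

theorem exists_glue_eq_of_mem_fixer (ht : 0 < t) (ha : ∀ i, 0 < a i) {u : SignedPerm (t + m)}
    (hu : u ∈ fixer (hyperplane h a b)) :
    ∃ (v : SignedPerm t) (w : SignedPerm m), glue v w = u := by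
  set A : Fin (t + m) → ℝ := Fin.append (fun i => (a i : ℝ)) 0 with hA
  have A_castAdd_pos (i : Fin t) : 0 < A (Fin.castAdd m i) := by simp [hA, ha]
  have A_natAdd (j : Fin m) : A (Fin.natAdd t j) = 0 := by simp [hA]
  have A_ne_zero : A ≠ 0 := fun h0 => (A_castAdd_pos ⟨0, ht⟩).ne' (congrFun h0 _)
  have A_nonneg : 0 ≤ A :=
    Fin.addCases (fun i => (A_castAdd_pos i).le) fun j => (A_natAdd j).ge
  rw [hyperplane_eq_setOf_append, mem_fixer_iff A_ne_zero A_nonneg] at hu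
  refine exists_glue_eq u fun i => ?_
  have A_perm := hu.1 (Fin.castAdd m i)
  generalize u.perm (Fin.castAdd m i) = k at A_perm ⊢
  induction k using Fin.addCases with
  | left j => exact ⟨j, rfl⟩
  | right j => exact absurd (A_perm ▸ A_natAdd j) (A_castAdd_pos i).ne'

/-- A symmetry of `Q_{t+m}` fixing a hyperplane in whose equation exactly the first `t` coordinates
occur is a symmetry of `Q_t` fixing that hyperplane glued to any symmetry of `Q_m`. -/
noncomputable def fixerEquiv (ht : 0 < t) (ha : ∀ i, 0 < a i) :
    fixer (hyperplane le_rfl a b) × SignedPerm m ≃ fixer (hyperplane h a b) :=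
  Equiv.ofBijective (fun p => ⟨glue p.1.1 p.2, (glue_mem_fixer_iff h).2 p.1.2⟩) <| by
    constructor
    · rintro ⟨v, w⟩ ⟨v', w'⟩ heq
      obtain ⟨hv, hw⟩ := glue_inj.1 (congrArg Subtype.val heq)
      exact Prod.ext (Subtype.ext hv) hw
    · rintro ⟨u, hu⟩
      obtain ⟨v, w, rfl⟩ := exists_glue_eq_of_mem_fixer h ht ha hu
      exact ⟨(⟨v, (glue_mem_fixer_iff h).1 hu⟩, w), rfl⟩

/-- The vertices of `Q_{t+m}` on a hyperplane in whose equation only the first `t` coordinates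
occur. -/
def verticesEquiv :
    ↥(vertices t ∩ hyperplane le_rfl a b) × vertices m ≃
      ↥(vertices (t + m) ∩ hyperplane h a b) where
  toFun p := ⟨Fin.append p.1.1 p.2.1, append_mem_vertices_iff.2 ⟨p.1.2.1, p.2.2⟩,
    (append_mem_hyperplane_iff h).2 p.1.2.2⟩
  invFun z := (⟨fun i => z.1 (Fin.castAdd m i), fun i => z.2.1 _, z.2.2⟩,
    ⟨fun i => z.1 (Fin.natAdd t i), fun i => z.2.1 _⟩)
  left_inv p := by ext <;> simp
  right_inv z := Subtype.ext Fin.append_castAdd_natAdd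

theorem hyperplaneCycleIndex_eq_sum_fixer (ht : 0 < t) (ha : ∀ i, 0 < a i) :
    hyperplaneCycleIndex (hyperplane h a b) =
      MvPolynomial.C (1 / (Fintype.card (fixer (hyperplane le_rfl a b)) : ℚ)) *
        ∑ π : fixer (hyperplane le_rfl a b), MvPolynomial.bind₁ (fOf π) (cubeCycleIndex m) :=
  cycleIndex_eq_of_prodEquiv (fixerEquiv h ht ha) (verticesEquiv h)
    fun v w x y => Subtype.ext (glue_smul_append v.1 w x.1 y.1).symm

end Gluing

section FiberStabilizer

variable {J K : Type*} (p : J → K)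

/-- The group of the permutations of `J` that map each fibre of `p` to itself. -/
def fiberStabilizer : Subgroup (Equiv.Perm J) where
  carrier := {σ | ∀ j, p (σ j) = p j}
  one_mem' _ := rfl
  mul_mem' hσ hτ j := (hσ _).trans (hτ j)
  inv_mem' {σ} hσ j := by rw [← hσ (σ⁻¹ j), Equiv.Perm.coe_inv, Equiv.apply_symm_apply]

/-- A permutation preserving the fibres of `p` is a family of permutations of the fibres. -/
def fiberPermEquiv : fiberStabilizer p ≃* ∀ k, Equiv.Perm {j // p j = k} where
  toFun σ k := σ.1.subtypePerm (p := fun j => p j = k) fun j => by rw [σ.2 j]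
  invFun f := ⟨(Equiv.sigmaFiberEquiv p).permCongr (Equiv.sigmaCongrRight f),
    fun j => (f (p j) ⟨j, rfl⟩).2⟩
  left_inv _ := rfl
  right_inv f := by
    ext k ⟨j, rfl⟩
    rfl
  map_mul' _ _ := rfl

variable {p} [Fintype J] [DecidableEq K] {α : K → ℕ}
  (hα : ∀ k, Fintype.card {j // p j = k} = α k)

/-- The cycle types of the restrictions of `σ` to the fibres of `p`, where `α k` is the size of the
fibre over `k`. -/
noncomputable def fiberCycleType (σ : fiberStabilizer p) (k : K) : (α k).Partition where
  parts := fullCycleType (fiberPermEquiv p σ k)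
  parts_pos h := fullCycleType_pos _ h
  parts_sum := by classical exact (Nat.Partition.parts_sum _).trans (hα k)

theorem fiberCycleType_eq_iff {σ : fiberStabilizer p} {μ : ∀ k, (α k).Partition} :
    fiberCycleType hα σ = μ ↔ ∀ k, fullCycleType (fiberPermEquiv p σ k) = (μ k).parts :=
  funext_iff.trans (forall_congr' fun _ => Nat.Partition.ext_iff)

theorem isConj_of_fiberCycleType_eq {σ τ : fiberStabilizer p}
    (h : fiberCycleType hα σ = fiberCycleType hα τ) : IsConj σ τ := by
  have isConj_fiber (k : K) : ∃ c, c * fiberPermEquiv p σ k * c⁻¹ = fiberPermEquiv p τ k :=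
    isConj_iff.1 (isConj_iff_fullCycleType_eq.2 ((fiberCycleType_eq_iff hα).1 h k))
  choose c hc using isConj_fiber
  have := (fiberPermEquiv p).symm.toMonoidHom.map_isConj (isConj_iff.2 ⟨c, funext hc⟩)
  simpa using this

theorem fiberCycleType_surjective : Function.Surjective (fiberCycleType (p := p) hα) := by
  obtain rfl : (fun k => Fintype.card {j // p j = k}) = α := funext hα
  intro μ
  choose σ hσ using fun k => exists_fullCycleType_eq (μ k)
  refine ⟨(fiberPermEquiv p).symm σ, (fiberCycleType_eq_iff hα).2 fun k => ?_⟩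
  rw [MulEquiv.apply_symm_apply, hσ]

variable [Fintype K] [Fintype (fiberStabilizer p)]

theorem card_fiberCycleType_mul_prod_zNumber (μ : ∀ k, (α k).Partition) :
    (Finset.univ.filter fun σ => fiberCycleType hα σ = μ).card * ∏ k, zNumber (μ k) =
      Fintype.card (fiberStabilizer p) := by
  classical
  obtain rfl : (fun k => Fintype.card {j // p j = k}) = α := funext hα
  have card_eq : (Finset.univ.filter fun σ => fiberCycleType hα σ = μ).card =
      (Fintype.piFinset fun k => Finset.univ.filter fun σ : Equiv.Perm {j // p j = k} =>
        fullCycleType σ = (μ k).parts).card :=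
    Finset.card_equiv (fiberPermEquiv p).toEquiv fun σ => by simp [fiberCycleType_eq_iff]
  rw [card_eq, Fintype.card_piFinset, ← Finset.prod_mul_distrib,
    Fintype.card_congr (fiberPermEquiv p).toEquiv, Fintype.card_pi]
  exact Finset.prod_congr rfl fun k _ =>
    (card_fullCycleType_mul_zNumber (μ k)).trans Fintype.card_perm.symm

theorem average_fiberCycleType {M : Type*} [AddCommGroup M] [Module ℚ M]
    (g : (∀ k, (α k).Partition) → M) :
    (1 / (Fintype.card (fiberStabilizer p) : ℚ)) • ∑ σ, g (fiberCycleType hα σ) =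
      ∑ μ, (∏ k, (zNumber (μ k) : ℚ)⁻¹) • g μ := by
  rw [← Finset.sum_fiberwise Finset.univ (fiberCycleType hα), Finset.smul_sum]
  refine Finset.sum_congr rfl fun μ _ => ?_
  have sum_fiber : ∑ σ with fiberCycleType hα σ = μ, g (fiberCycleType hα σ) =
      (Finset.univ.filter fun σ => fiberCycleType hα σ = μ).card • g μ :=
    Finset.sum_eq_card_nsmul fun σ hσ => congrArg g (Finset.mem_filter.1 hσ).2
  have card_mul := card_fiberCycleType_mul_prod_zNumber hα μ
  have card_ne_zero : (Fintype.card (fiberStabilizer p) : ℚ) ≠ 0 := by simp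
  rw [sum_fiber, ← Nat.cast_smul_eq_nsmul ℚ, smul_smul, Finset.prod_inv_distrib]
  congr 1
  rw [← card_mul] at card_ne_zero ⊢
  push_cast at card_ne_zero ⊢
  rw [one_div_mul_eq_div, div_mul_cancel_left₀ (left_ne_zero_of_mul card_ne_zero)]

end FiberStabilizer

section Blocks

theorem mem_block_iff_of_monotone {t l : ℕ} {p : Fin t → Fin l} (hp : Monotone p)
    {α : Fin l → ℕ} (hα : ∀ k, Fintype.card {j // p j = k} = α k) {k : Fin l} {j : Fin t} :
    j ∈ block α k ↔ p j = k := by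
  have sum_eq (s : Finset (Fin l)) : ∑ i ∈ s, α i = (Finset.univ.filter fun j => p j ∈ s).card := by
    rw [← Finset.sum_card_fiberwise_eq_card_filter]
    exact Finset.sum_congr rfl fun i _ => (hα i).symm.trans (Fintype.card_subtype _)
  simp only [block, Finset.mem_filter_univ, sum_eq, Finset.mem_Iio, Finset.mem_Iic]
  rw [← not_lt, Tuple.lt_card_lt_iff_apply_lt_of_monotone hp,
    Tuple.lt_card_le_iff_apply_le_of_monotone hp, not_lt, ← le_antisymm_iff, eq_comm]

variable {t : ℕ} {a : Fin t → ℕ} (ha : ∀ i, 0 < a i)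

/-- The index of the block containing a letter. As for `hyperplaneType`, blocks are numbered from
`0`, so that the block of the letters with coefficient `k` has index `k - 1`. -/
def blockIndex (j : Fin t) : Fin (typeLength a) :=
  ⟨a j - 1, (Nat.sub_one_lt (ha j).ne').trans_le (Finset.le_sup (f := a) (Finset.mem_univ j))⟩

theorem blockIndex_eq_iff {j : Fin t} {k : Fin (typeLength a)} :
    blockIndex ha j = k ↔ a j = k.1 + 1 := by
  rw [Fin.ext_iff, blockIndex, Nat.sub_eq_iff_eq_add (ha j)]

theorem blockIndex_eq_blockIndex_iff {i j : Fin t} :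
    blockIndex ha i = blockIndex ha j ↔ a i = a j := by
  rw [blockIndex_eq_iff, blockIndex, Nat.sub_add_cancel (ha j)]

theorem card_blockIndex_fiber (k : Fin (typeLength a)) :
    Fintype.card {j // blockIndex ha j = k} = hyperplaneType a k := by
  rw [Fintype.card_subtype, hyperplaneType]
  simp only [blockIndex_eq_iff]

theorem mem_block_iff (hmono : Monotone a) {k : Fin (typeLength a)} {j : Fin t} :
    j ∈ block (hyperplaneType a) k ↔ blockIndex ha j = k :=
  mem_block_iff_of_monotone (fun _ _ hij => Nat.sub_le_sub_right (hmono hij) 1)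
    (card_blockIndex_fiber ha)

theorem forall_mem_block_iff (hmono : Monotone a) {σ : Equiv.Perm (Fin t)} :
    (∀ k j, σ j ∈ block (hyperplaneType a) k ↔ j ∈ block (hyperplaneType a) k) ↔
      σ ∈ fiberStabilizer (blockIndex ha) := by
  simp only [mem_block_iff ha hmono]
  exact ⟨fun h j => (h _ j).2 rfl, fun h k j => by rw [h j]⟩

theorem hasBlockTypes_iff (hmono : Monotone a) {μ : ∀ k, (hyperplaneType a k).Partition}
    (σ : fiberStabilizer (blockIndex ha)) :
    HasBlockTypes μ σ.1 ↔ fiberCycleType (card_blockIndex_fiber ha) σ = μ := by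
  rw [fiberCycleType_eq_iff]
  refine forall_congr' fun k => ?_
  rw [exists_prop_of_true ((forall_mem_block_iff ha hmono).2 σ.2 k),
    fullCycleType_eq_of_semiconj (Equiv.subtypeEquivRight fun j => mem_block_iff ha hmono)
      (h := fiberPermEquiv _ σ k) fun _ => rfl]

end Blocks

section BlockSymmetries

variable {t : ℕ} {a : Fin t → ℕ} {b : ℕ} (ha : ∀ i, 0 < a i)

/-- The symmetry of the hyperplane all of whose signs are `s` and whose underlying permutation `σ`
preserves the blocks: an element of `S_α` for `s = false`, and of `S̄_α` for `s = true`. -/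
def blockSymmetry (s : Bool) (hs : s = true → ∑ i, a i = 2 * b)
    (σ : fiberStabilizer (blockIndex ha)) : fixer (hyperplane le_rfl a b) :=
  ⟨⟨σ.1, fun _ => s⟩, SignedPerm.mem_fixer_of_uniform (A := fun i => (a i : ℝ))
    (fun i => congrArg _ ((blockIndex_eq_blockIndex_iff ha).1 (σ.2 i))) (fun _ _ => rfl)
    fun h => by exact_mod_cast hs h⟩

theorem isConj_blockSymmetry {s : Bool} {hs : s = true → ∑ i, a i = 2 * b}
    {σ τ : fiberStabilizer (blockIndex ha)} (h : IsConj σ τ) :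
    IsConj (blockSymmetry ha s hs σ) (blockSymmetry ha s hs τ) := by
  obtain ⟨c, hc⟩ := isConj_iff.1 h.symm
  -- The product of signed permutations composes the underlying permutations in reverse order.
  refine isConj_iff.2 ⟨blockSymmetry ha false (by simp) c, mul_inv_eq_of_eq_mul (Subtype.ext ?_)⟩
  exact SignedPerm.ext (congrArg Subtype.val (eq_mul_of_mul_inv_eq hc).symm)
    (funext fun _ => Bool.xor_comm false s)

theorem fOf_blockSymmetry_eq {s : Bool} {hs : s = true → ∑ i, a i = 2 * b}
    {σ τ : fiberStabilizer (blockIndex ha)}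
    (h : fiberCycleType (card_blockIndex_fiber ha) σ =
      fiberCycleType (card_blockIndex_fiber ha) τ) :
    fOf (blockSymmetry ha s hs σ) = fOf (blockSymmetry ha s hs τ) := by
  funext j
  rw [fOf, fOf, fullCycleType_toPerm_eq_of_isConj
    (isConj_blockSymmetry ha (isConj_of_fiberCycleType_eq _ h))]

/-- The common form of `IsFmu` (for `s = false`) and `IsFmuBar` (for `s = true`), each of which
unfolds to it. -/
def IsSignedFmu (s : Bool) (a : Fin t → ℕ) (b : ℕ) (μ : ∀ k, (hyperplaneType a k).Partition)
    (F : ℕ → MvPolynomial ℕ ℚ) : Prop :=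
  ∃ π : fixer (hyperplane (le_refl t) a b),
    ((∀ j, π.1.neg j = s) ∧ ∀ k j, π.1.perm j ∈ block (hyperplaneType a) k ↔
      j ∈ block (hyperplaneType a) k) ∧ HasBlockTypes μ π.1.perm ∧ F = fOf π

theorem isSignedFmu_iff (hmono : Monotone a) {s : Bool}
    (hs : s = true → ∑ i, a i = 2 * b) (σ : fiberStabilizer (blockIndex ha))
    {F : ℕ → MvPolynomial ℕ ℚ} :
    IsSignedFmu s a b (fiberCycleType (card_blockIndex_fiber ha) σ) F ↔
      F = fOf (blockSymmetry ha s hs σ) := by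
  constructor
  · rintro ⟨⟨⟨τ, _⟩, hπ⟩, ⟨hneg, hτ⟩, hμ, rfl⟩
    obtain rfl : _ = fun _ => s := funext hneg
    rw [forall_mem_block_iff ha hmono] at hτ
    exact fOf_blockSymmetry_eq ha (σ := ⟨τ, hτ⟩) ((hasBlockTypes_iff ha hmono _).1 hμ)
  · intro hF
    exact ⟨blockSymmetry ha s hs σ, ⟨fun _ => rfl, (forall_mem_block_iff ha hmono).2 σ.2⟩,
      (hasBlockTypes_iff ha hmono σ).2 rfl, hF⟩

include ha in
theorem existsUnique_isSignedFmu (hmono : Monotone a) {s : Bool}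
    (hs : s = true → ∑ i, a i = 2 * b) (μ : ∀ k, (hyperplaneType a k).Partition) :
    ∃! F, IsSignedFmu s a b μ F := by
  obtain ⟨σ, rfl⟩ := fiberCycleType_surjective (card_blockIndex_fiber ha) μ
  simp only [isSignedFmu_iff ha hmono hs, existsUnique_eq]

theorem delta_eq_one_iff : delta a b = 1 ↔ ∑ i, a i = 2 * b := by
  simp [delta]

theorem blockSymmetry_bijective (ht : 0 < t) :
    Function.Bijective fun p : {s : Bool // s = true → ∑ i, a i = 2 * b} ×
      fiberStabilizer (blockIndex ha) => blockSymmetry ha p.1.1 p.1.2 p.2 := by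
  have coeff_ne_zero (i : Fin t) : (a i : ℝ) ≠ 0 := Nat.cast_ne_zero.2 (ha i).ne'
  constructor
  · rintro ⟨⟨s, _⟩, σ⟩ ⟨⟨s', _⟩, σ'⟩ h
    obtain ⟨hperm, hneg⟩ := (SignedPerm.mk.injEq ..).mp (congrArg Subtype.val h)
    exact Prod.ext (Subtype.ext (congrFun hneg ⟨0, ht⟩)) (Subtype.ext hperm)
  · rintro ⟨⟨σ, neg⟩, hw⟩
    obtain ⟨hσ, s, hneg, hs⟩ := (SignedPerm.mem_fixer_iff (A := fun i => (a i : ℝ))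
      (Function.ne_iff.2 ⟨⟨0, ht⟩, coeff_ne_zero _⟩) fun _ => Nat.cast_nonneg _).1 hw
    exact ⟨(⟨s, fun h => by exact_mod_cast hs h⟩,
      ⟨σ, fun i => (blockIndex_eq_blockIndex_iff ha).2 (Nat.cast_injective (hσ i))⟩),
      Subtype.ext (SignedPerm.ext rfl (funext fun i => (hneg i (coeff_ne_zero i)).symm))⟩

theorem sum_subtype_bool_imp {M : Type*} [AddCommMonoid M] {P : Prop} [Decidable P]
    (φ : {s : Bool // s = true → P} → M) :
    ∑ s, φ s = φ ⟨false, by simp⟩ + if h : P then φ ⟨true, fun _ => h⟩ else 0 := by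
  split_ifs with h
  · have univ_eq : (Finset.univ : Finset {s : Bool // s = true → P}) =
        {⟨false, by simp⟩, ⟨true, fun _ => h⟩} := by
      ext ⟨s, hs⟩
      cases s <;> simp
    rw [univ_eq, Finset.sum_pair (by simp)]
  · have unique (s : {s : Bool // s = true → P}) : s = ⟨false, by simp⟩ :=
      Subtype.ext (Bool.eq_false_iff.2 fun hs => h (s.2 hs))
    rw [add_zero, Fintype.sum_eq_single _ fun s hs => absurd (unique s) hs]

theorem sum_fixer_hyperplane {M : Type*} [AddCommMonoid M]
    [Fintype (fiberStabilizer (blockIndex ha))] (ht : 0 < t)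
    (φ : fixer (hyperplane le_rfl a b) → M) :
    ∑ π, φ π = ∑ σ, φ (blockSymmetry ha false (by simp) σ) +
      if h : ∑ i, a i = 2 * b then ∑ σ, φ (blockSymmetry ha true (fun _ => h) σ) else 0 := by
  rw [← (blockSymmetry_bijective ha ht).sum_comp, Fintype.sum_prod_type, sum_subtype_bool_imp]

theorem card_fixer_hyperplane [Fintype (fiberStabilizer (blockIndex ha))] (ht : 0 < t) :
    Fintype.card (fixer (hyperplane le_rfl a b)) =
      2 ^ delta a b * Fintype.card (fiberStabilizer (blockIndex ha)) := by
  rw [Fintype.card_eq_sum_ones, sum_fixer_hyperplane ha ht, ← Fintype.card_eq_sum_ones, delta]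
  split_ifs <;> ring

include ha in
theorem average_fixer_hyperplane (hmono : Monotone a) (ht : 0 < t) (Z : MvPolynomial ℕ ℚ)
    {f fbar : (∀ k, (hyperplaneType a k).Partition) → ℕ → MvPolynomial ℕ ℚ}
    (hf : ∀ μ, IsSignedFmu false a b μ (f μ))
    (hfbar : delta a b = 1 → ∀ μ, IsSignedFmu true a b μ (fbar μ)) :
    MvPolynomial.C (1 / (Fintype.card (fixer (hyperplane (le_refl t) a b)) : ℚ)) *
        ∑ π : fixer (hyperplane (le_refl t) a b), MvPolynomial.bind₁ (fOf π) Z =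
      MvPolynomial.C (1 / 2 ^ delta a b) *
        ∑ μ : ∀ k, (hyperplaneType a k).Partition,
          MvPolynomial.C (∏ k, ((zNumber (μ k) : ℚ))⁻¹) *
            (MvPolynomial.bind₁ (f μ) Z +
              MvPolynomial.C (delta a b : ℚ) * MvPolynomial.bind₁ (fbar μ) Z) := by
  classical
  have sum_eq : ∑ π : fixer (hyperplane (le_refl t) a b), MvPolynomial.bind₁ (fOf π) Z =
      ∑ σ, (fun μ => MvPolynomial.bind₁ (f μ) Z +
        MvPolynomial.C (delta a b : ℚ) * MvPolynomial.bind₁ (fbar μ) Z)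
          (fiberCycleType (card_blockIndex_fiber ha) σ) := by
    rw [sum_fixer_hyperplane ha ht, Finset.sum_add_distrib]
    congr 1
    · exact Finset.sum_congr rfl fun σ _ => by
        rw [(isSignedFmu_iff ha hmono _ σ).1 (hf _)]
    · split_ifs with h
      · have hδ := delta_eq_one_iff.2 h
        refine Finset.sum_congr rfl fun σ _ => ?_
        rw [(isSignedFmu_iff ha hmono (fun _ => h) σ).1 (hfbar hδ _), hδ, Nat.cast_one,
          MvPolynomial.C_1, one_mul]
      · simp [delta, h]
  simp only [MvPolynomial.C_mul'] at sum_eq ⊢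
  rw [sum_eq, card_fixer_hyperplane ha ht, ← average_fiberCycleType (card_blockIndex_fiber ha),
    smul_smul]
  push_cast
  rw [one_div_mul_one_div]

end BlockSymmetries

end CubeIndex

theorem theorem6p3_general {n t : ℕ} (ht : 0 < t) (htn : t ≤ n) (a : Fin t → ℕ) (b : ℕ)
    (ha : ∀ i, 0 < a i) (hmono : Monotone a) :
    (∀ μ : ∀ k, (hyperplaneType a k).Partition, ∃! F, IsFmu a b μ F) ∧
    (delta a b = 1 → ∀ μ : ∀ k, (hyperplaneType a k).Partition, ∃! F, IsFmuBar a b μ F) ∧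
    ∀ f fbar : (∀ k, (hyperplaneType a k).Partition) → ℕ → MvPolynomial ℕ ℚ,
      (∀ μ, IsFmu a b μ (f μ)) →
      (delta a b = 1 → ∀ μ, IsFmuBar a b μ (fbar μ)) →
      hyperplaneCycleIndex (hyperplane htn a b) =
        MvPolynomial.C (1 / 2 ^ delta a b) *
          ∑ μ : ∀ k, (hyperplaneType a k).Partition,
            MvPolynomial.C (∏ k, ((zNumber (μ k) : ℚ))⁻¹) *
              (MvPolynomial.bind₁ (f μ) (cubeCycleIndex (n - t)) +
                MvPolynomial.C (delta a b : ℚ) *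
                  MvPolynomial.bind₁ (fbar μ) (cubeCycleIndex (n - t))) := by
  refine ⟨existsUnique_isSignedFmu ha hmono (by simp),
    fun hδ => existsUnique_isSignedFmu ha hmono fun _ => delta_eq_one_iff.1 hδ,
    fun f fbar hf hfbar => ?_⟩
  obtain ⟨m, rfl⟩ := Nat.exists_eq_add_of_le htn
  rw [Nat.add_sub_cancel_left, hyperplaneCycleIndex_eq_sum_fixer htn ht ha]
  exact average_fixer_hyperplane ha hmono ht (cubeCycleIndex m) hf hfbar

theorem theorem6p3 {n t : ℕ} (ht : 0 < t) (htn : t ≤ n) (a : Fin t → ℕ) (b : ℕ)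
    (ha : ∀ i, 0 < a i) (hmono : Monotone a) (hspan : IsSpanned (hyperplane htn a b)) :
    -- `f_μ` is well defined, and so is its barred version when `δ(H) = 1`
    (∀ μ : ∀ k, (hyperplaneType a k).Partition, ∃! F, IsFmu a b μ F) ∧
    (delta a b = 1 → ∀ μ : ∀ k, (hyperplaneType a k).Partition, ∃! F, IsFmuBar a b μ F) ∧
    -- the formula for the cycle index
    ∀ f fbar : (∀ k, (hyperplaneType a k).Partition) → ℕ → MvPolynomial ℕ ℚ,
      (∀ μ, IsFmu a b μ (f μ)) →
      (delta a b = 1 → ∀ μ, IsFmuBar a b μ (fbar μ)) →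
      hyperplaneCycleIndex (hyperplane htn a b) =
        MvPolynomial.C (1 / 2 ^ delta a b) *
          ∑ μ : ∀ k, (hyperplaneType a k).Partition,
            MvPolynomial.C (∏ k, ((zNumber (μ k) : ℚ))⁻¹) *
              (MvPolynomial.bind₁ (f μ) (cubeCycleIndex (n - t)) +
                MvPolynomial.C (delta a b : ℚ) *
                  MvPolynomial.bind₁ (fbar μ) (cubeCycleIndex (n - t))) :=
  theorem6p3_general ht htn a b ha hmono
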